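/- Let $d\ge 1$ be an integer, $|\cdot|$ the Euclidean norm on $\mathbb{R}^d$, $\mathbb{R}_+=[0,\infty)$ and $E=L^\infty(\mathbb{R}^d,dx)$ with the ess-sup norm. Let $m>0$ and $\beta:=\varkappa-m>0$. Let $a$ be an essentially bounded probability kernel: $0\le a\in L^1(\mathbb{R}^d)\cap E$, $\int a\,dx=1$. Pointwise inequalities between functions on $\mathbb{R}^d$ below hold for almost all $x$. Put $\Delta(x)=\{y\in\mathbb{R}^d: y_j\ge x_j,\ 1\le j\le d\}$. **Classes of functions.** $\mathcal D_d$ is the set of bounded measurable $b:\mathbb{R}_+\to(0,\infty)$ such that for some $\rho\ge 0$ the function $b$ is strictly decreasing on $[\rho,\infty)$ to $0$, $\int_0^\infty b(s)s^{d-1}ds<\infty$, and $\inf_{0\le s<r}b(s)>0$ for each $r>0$. $\mathcal E_d$ is the set of $b\in\mathcal D_d$ such that: - $b(s+\tau)/b(s)\to 1$ as $s\to\infty$ for every $\tau\ge 0$; - for some $\rho\ge0$, $b$ is strictly decreasing on $[\rho,\infty)$ to $0$, $\log b$ is convex on $(\rho,\infty)$ and $b(\rho)\le 1$; - there are $\delta\in(0,1)$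 and a non-decreasing $h:(0,\infty)\to(0,\infty)$ with $h(s)<s/2$ for all $s>0$ and $h(s)\to\infty$ as $s\to\infty$, such that $b(s\pm h(s))/b(s)\to 1$ and $b(h(s))s^{1+\delta}\to 0$ as $s\to\infty$; - if $d>1$, then either $b(s)=M(1+s)^{-(d+\mu)}$ for all $s\in\mathbb{R}_+$, with some $M,\mu>0$, or $b(s)s^\nu\to0$ as $s\to\infty$ for every $\nu\ge 1$. Functions $p,q\in\mathcal D_d$ are log-equivalent if $\log p(s)\sim\log q(s)$ as $s\to\infty$. **Theorem.** Let $0\le u_0\in E$ and let $w:\mathbb{R}_+\to E$ be the classical solution (continuous on $\mathbb{R}_+$, continuously differentiable on $(0,\infty)$ in the norm of $E$) of $$\frac{\partial w}{\partial t}(x,t)=\varkappa\int_{\mathbb{R}^d}a(x-y)w(y,t)\,dy-m\,w(x,t)\quad(t>0),\qquad w(x,0)=u_0(x).$$ Let $b\in\mathcal E_d$ and let $b_1,b_2\in\mathcal D_d$ both be log-equivalent to $b$. Suppose that $a(x)\le b_1(|x|)$, and that either - $u_0(x)\le b_2(|x|)$, and $c(x):=b(|x|)$ for $x\in\mathbb{R}^d$;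 or - $u_0(x)\le\int_{\Delta(x)}b_2(|y|)\,dy$, and $c(x):=\int_{\Delta(x)}b(|y|)\,dy$ for $x\in\mathbb{R}^d$. For $t>0$ put $\Lambda(t,c)=\{x\in\mathbb{R}^d: c(x)\ge e^{-\beta t}\}$. Then there is $\varepsilon_0>0$ such that for every $\varepsilon\in(0,\varepsilon_0)$ there exist $C_\varepsilon,\tau_\varepsilon>0$ with $$\operatorname*{ess\,sup}_{x\in\mathbb{R}^d\setminus\Lambda(t+\varepsilon t,\,c)}w(x,t)\le C_\varepsilon e^{-\frac{\varepsilon\beta}{4}t}\qquad\text{for all } t\ge\tau_\varepsilon.$$ -/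

import Mathlib

open MeasureTheory Filter Set
open scoped Topology ENNReal

namespace NonlocalFront

/-- `ℝ^d` with the Euclidean norm. -/
abbrev Space (d : ℕ) : Type := EuclideanSpace ℝ (Fin d)

/-- The Banach space `E = L^∞(ℝ^d, dx)` with the ess-sup norm. -/
abbrev LInfty (d : ℕ) : Type := Lp ℝ ∞ (volume : Measure (Space d))

/-- An essentially bounded probability kernel:
`0 ≤ a ∈ L^1 ∩ L^∞` and `∫ a = 1`. -/
structure IsBoundedProbabilityKernel {d : ℕ} (a : Space d → ℝ) : Prop where
  nonneg : ∀ᵐ x, 0 ≤ a x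
  integrable : Integrable a
  essBounded : MemLp a ∞ volume
  integral_eq_one : ∫ x, a x = 1

/-- The convolution in the space variable, `(a * v)(x) = ∫ a(x - y) v(y) dy`. -/
noncomputable def conv {d : ℕ} (a v : Space d → ℝ) (x : Space d) : ℝ :=
  ∫ y, a (x - y) * v y

/-- `w : [0, ∞) → E` is a classical solution to the initial value problem
`∂w/∂t = κ a * w - m w`, `w(·, 0) = u₀`: it is continuous on `[0, ∞)`, continuously
differentiable on `(0, ∞)` with respect to the norm of `E`, and satisfies the equation in `E`
for every `t > 0`. The values of `w` at negative times play no role. -/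
structure IsClassicalSolution {d : ℕ} (κ m : ℝ) (a : Space d → ℝ) (u₀ : LInfty d)
    (w : ℝ → LInfty d) : Prop where
  initial : w 0 = u₀
  continuousOn : ContinuousOn w (Ici 0)
  contDiffOn : ContDiffOn ℝ 1 w (Ioi 0)
  equation : ∀ t : ℝ, 0 < t → ∀ᵐ x, deriv w t x = κ * conv a (w t) x - m * w t x

/-! Functions on `ℝ_+ = [0, ∞)` are given by functions `b : ℝ → ℝ`, of which only the values at
`s ≥ 0` are used. -/

/-- Long-tailed: `b(s + τ) / b(s) → 1` as `s → ∞`, for every `τ ≥ 0`. -/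
def LongTailed (b : ℝ → ℝ) : Prop :=
  ∀ τ : ℝ, 0 ≤ τ → Tendsto (fun s => b (s + τ) / b s) atTop (𝓝 1)

/-- Strictly decreasing on `[ρ, ∞)` to `0`. -/
def TailDecreasingFrom (ρ : ℝ) (b : ℝ → ℝ) : Prop :=
  StrictAntiOn b (Ici ρ) ∧ Tendsto b atTop (𝓝 0)

/-- `log b` is convex on `(ρ, ∞)`. -/
def TailLogConvexFrom (ρ : ℝ) (b : ℝ → ℝ) : Prop :=
  ConvexOn ℝ (Ioi ρ) (fun s => Real.log (b s))

/-- The class of bounded measurable tail-decreasing functions `b : [0, ∞) → (0, ∞)` with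
`∫_0^∞ b(s) s^(d-1) ds < ∞` that are separated from `0` on bounded intervals. -/
structure ClassD (d : ℕ) (b : ℝ → ℝ) : Prop where
  measurable : Measurable (fun s : Ici (0 : ℝ) => b s)
  pos : ∀ s : ℝ, 0 ≤ s → 0 < b s
  bounded : ∃ K : ℝ, ∀ s : ℝ, 0 ≤ s → b s ≤ K
  tailDecreasing : ∃ ρ : ℝ, 0 ≤ ρ ∧ TailDecreasingFrom ρ b
  integrable : IntegrableOn (fun s => b s * s ^ (d - 1)) (Ioi 0)
  inf_pos : ∀ r : ℝ, 0 < r → ∃ k : ℝ, 0 < k ∧ ∀ s : ℝ, 0 ≤ s → s < r → k ≤ b s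

/-- The class of regular heavy-tailed functions. -/
structure ClassE (d : ℕ) (b : ℝ → ℝ) : Prop extends ClassD d b where
  longTailed : LongTailed b
  tail : ∃ ρ : ℝ, 0 ≤ ρ ∧ TailDecreasingFrom ρ b ∧ TailLogConvexFrom ρ b ∧ b ρ ≤ 1
  insensitive : ∃ δ : ℝ, 0 < δ ∧ δ < 1 ∧ ∃ h : ℝ → ℝ,
    MonotoneOn h (Ioi 0) ∧ (∀ s : ℝ, 0 < s → 0 < h s ∧ h s < s / 2) ∧
    Tendsto h atTop atTop ∧
    Tendsto (fun s => b (s + h s) / b s) atTop (𝓝 1) ∧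
    Tendsto (fun s => b (s - h s) / b s) atTop (𝓝 1) ∧
    Tendsto (fun s => b (h s) * s ^ (1 + δ)) atTop (𝓝 0)
  multidim : 1 < d →
    (∃ μ M : ℝ, 0 < μ ∧ 0 < M ∧ ∀ s : ℝ, 0 ≤ s → b s = M / (1 + s) ^ ((d : ℝ) + μ)) ∨
    (∀ ν : ℝ, 1 ≤ ν → Tendsto (fun s => b s * s ^ ν) atTop (𝓝 0))

/-- Asymptotic log-equivalence: `log b₁(s) ~ log b₂(s)` as `s → ∞`. -/
def LogEquivalent (b₁ b₂ : ℝ → ℝ) : Prop :=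
  Asymptotics.IsEquivalent atTop (fun s => Real.log (b₁ s)) (fun s => Real.log (b₂ s))

/-- The orthant `Δ(x) = {y : y_j ≥ x_j for all j}`. -/
def orthant {d : ℕ} (x : Space d) : Set (Space d) := {y | ∀ j, x j ≤ y j}

/-- The radial function `x ↦ b(|x|)`. -/
noncomputable def radial {d : ℕ} (b : ℝ → ℝ) (x : Space d) : ℝ := b ‖x‖

/-- The function `x ↦ ∫_{Δ(x)} b(|y|) dy`. -/
noncomputable def orthantIntegral {d : ℕ} (b : ℝ → ℝ) (x : Space d) : ℝ :=
  ∫ y in orthant x, b ‖y‖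

/-- The set `Λ(t, c) = {x : c(x) ≥ e^(-β t)}`. -/
def frontSet {d : ℕ} (β t : ℝ) (c : Space d → ℝ) : Set (Space d) :=
  {x | Real.exp (-(β * t)) ≤ c x}

end NonlocalFront

open NonlocalFront

/-! With `A` the convolution with `a`, the solution is `e^{-mt} exp(κtA) u₀`, and `A` preserves
order. Hence if `u₀ ≤ ω` and `Aω ≤ γω`, then `w(t) ≤ e^{(κγ - m)t} ω`
(`IsClassicalSolution.ae_le_of_conv_le`). Take `γ = 1 + εβ/(4κ)`, so the growth rate is `β(1 +
ε/4)`, and suppose `ω ≤ D c^θ` with `θ = (1 + ε/2)/(1 + ε)`. Ahead of the front `c < e^{-β(1+ε)t}`,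
so `c^θ ≤ e^{-β(1+ε/2)t}`, and the product decays at rate `εβ/4`.

It remains to build `ω`. Let `f` be a monotone version of `b`. Log-equivalence bounds `a` and `u₀`
by any power of `f` below the first (`ClassD.exists_le_mul_rpow`). For a suitable `α < 1`,
`f(|x|)^α` is an asymptotic supersolution for every `γ > 1` (`conv_norm_rpow_le`,
`eventually_conv_norm_rpow_le`): short jumps barely change a long-tailed function, jumps of length
close to `|x|` cost a power of `f` higher than `α`, and log-convexity makes the intermediate jumps
negligible. Flattening near the origin makes the supersolution global.

In the orthant case the supersolution is integrated over `Δ(x)`, which commutes with convolution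
(`conv_setIntegral_orthant_le`); Hölder's inequality (`TailProfile.setIntegral_rpow_le`) compares
the result with `c^θ`. -/

namespace NonlocalFront

/-! ### Convolution as a positive contraction of `L^∞`. -/

section Convolution

variable {d : ℕ} {a : Space d → ℝ}

theorem IsBoundedProbabilityKernel.integrable_conv_integrand (ha : IsBoundedProbabilityKernel a)
    {v : Space d → ℝ} (hv : MemLp v ∞ volume) (x : Space d) :
    Integrable (fun y => a (x - y) * v y) :=
  (ha.integrable.comp_sub_left x).mul_of_top_left hv

theorem IsBoundedProbabilityKernel.nonneg_comp_sub_left (ha : IsBoundedProbabilityKernel a)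
    (x : Space d) : ∀ᵐ y, 0 ≤ a (x - y) :=
  (quasiMeasurePreserving_sub_left volume x).ae ha.nonneg

theorem IsBoundedProbabilityKernel.aestronglyMeasurable_conv (ha : IsBoundedProbabilityKernel a)
    {v : Space d → ℝ} (hv : AEStronglyMeasurable v volume) :
    AEStronglyMeasurable (conv a v) volume := by
  have h := (hv.convolution_integrand (μ := (volume : Measure (Space d)))
    (ContinuousLinearMap.mul ℝ ℝ) ha.integrable.aestronglyMeasurable).integral_prod_right'
  refine h.congr (ae_of_all _ fun x => ?_)
  simp only [conv, ContinuousLinearMap.mul_apply', mul_comm]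

theorem conv_congr {u v : Space d → ℝ} (h : u =ᵐ[volume] v) : conv a u = conv a v := by
  funext x
  exact integral_congr_ae (h.mono fun y hy => by simp only [hy])

theorem conv_add (ha : IsBoundedProbabilityKernel a) {u v : Space d → ℝ}
    (hu : MemLp u ∞ volume) (hv : MemLp v ∞ volume) :
    conv a (u + v) = conv a u + conv a v := by
  funext x
  simp only [conv, Pi.add_apply, mul_add]
  exact integral_add (ha.integrable_conv_integrand hu x) (ha.integrable_conv_integrand hv x)

theorem conv_smul (r : ℝ) (v : Space d → ℝ) : conv a (r • v) = r • conv a v := by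
  funext x
  simp only [conv, Pi.smul_apply, smul_eq_mul]
  rw [← integral_const_mul]
  congr 1 with y
  ring

theorem conv_mono (ha : IsBoundedProbabilityKernel a) {u v : Space d → ℝ}
    (hu : MemLp u ∞ volume) (hv : MemLp v ∞ volume) (h : u ≤ᵐ[volume] v) (x : Space d) :
    conv a u x ≤ conv a v x := by
  refine integral_mono_ae (ha.integrable_conv_integrand hu x) (ha.integrable_conv_integrand hv x) ?_
  filter_upwards [h, ha.nonneg_comp_sub_left x] with y hy hay
  exact mul_le_mul_of_nonneg_left hy hay

theorem conv_const (ha : IsBoundedProbabilityKernel a) (r : ℝ) (x : Space d) :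
    conv a (fun _ => r) x = r := by
  simp only [conv]
  rw [integral_mul_const, integral_sub_left_eq_self a volume x, ha.integral_eq_one, one_mul]

theorem abs_conv_le (ha : IsBoundedProbabilityKernel a) {v : Space d → ℝ} {K : ℝ}
    (hv : MemLp v ∞ volume) (hK : ∀ᵐ y, ‖v y‖ ≤ K) (x : Space d) : ‖conv a v x‖ ≤ K := by
  have hc (r : ℝ) : MemLp (fun _ : Space d => r) ∞ volume := memLp_top_const r
  rw [Real.norm_eq_abs, abs_le]
  constructor
  · rw [← conv_const ha (-K) x]
    exact conv_mono ha (hc _) hv (hK.mono fun y hy => (abs_le.1 hy).1) x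
  · rw [← conv_const ha K x]
    exact conv_mono ha hv (hc _) (hK.mono fun y hy => (abs_le.1 hy).2) x

theorem LInfty.ae_norm_le (v : LInfty d) : ∀ᵐ y, ‖v y‖ ≤ ‖v‖ := by
  have h := ae_le_eLpNormEssSup (f := v) (μ := (volume : Measure (Space d)))
  have hfin : eLpNormEssSup v (volume : Measure (Space d)) ≠ ∞ := by
    simpa [eLpNorm_exponent_top] using (Lp.memLp v).eLpNorm_ne_top
  filter_upwards [h] with y hy
  rw [Lp.norm_def, eLpNorm_exponent_top, ← toReal_enorm]
  exact ENNReal.toReal_mono hfin hy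

theorem memLp_conv (ha : IsBoundedProbabilityKernel a) {v : Space d → ℝ}
    (hv : MemLp v ∞ volume) : MemLp (conv a v) ∞ volume := by
  refine memLp_top_of_bound (ha.aestronglyMeasurable_conv hv.1) ‖hv.toLp v‖ (ae_of_all _ fun x => ?_)
  refine abs_conv_le ha hv ?_ x
  filter_upwards [LInfty.ae_norm_le (hv.toLp v), hv.coeFn_toLp] with y hy hy'
  rwa [hy'] at hy

/-- Convolution with a bounded probability kernel as a bounded operator on `L^∞`. -/
noncomputable def convOp (ha : IsBoundedProbabilityKernel a) : LInfty d →L[ℝ] LInfty d :=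
  LinearMap.mkContinuous
    { toFun := fun v => (memLp_conv ha (Lp.memLp v)).toLp (conv a v)
      map_add' := fun u v => by
        rw [← MemLp.toLp_add]
        refine MemLp.toLp_congr _ _ (ae_of_all _ fun x => ?_)
        rw [conv_congr (Lp.coeFn_add u v), conv_add ha (Lp.memLp u) (Lp.memLp v)]
      map_smul' := fun r v => by
        rw [RingHom.id_apply, ← MemLp.toLp_const_smul]
        refine MemLp.toLp_congr _ _ (ae_of_all _ fun x => ?_)
        rw [conv_congr (Lp.coeFn_smul r v), conv_smul] }
    1 fun v => by
      rw [one_mul]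
      set z : LInfty d := (memLp_conv ha (Lp.memLp v)).toLp (conv a v) with hz
      change ‖z‖ ≤ ‖v‖
      rw [Lp.norm_def]
      refine ENNReal.toReal_le_of_le_ofReal (norm_nonneg v) ?_
      rw [eLpNorm_exponent_top]
      refine eLpNormEssSup_le_of_ae_bound ?_
      filter_upwards [(memLp_conv ha (Lp.memLp v)).coeFn_toLp] with x hx
      rw [hz, hx]
      exact abs_conv_le ha (Lp.memLp v) (LInfty.ae_norm_le v) x

theorem coeFn_convOp (ha : IsBoundedProbabilityKernel a) (v : LInfty d) :
    convOp ha v =ᵐ[volume] conv a v :=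
  (memLp_conv ha (Lp.memLp v)).coeFn_toLp

theorem convOp_mono (ha : IsBoundedProbabilityKernel a) {u v : LInfty d} (h : u ≤ v) :
    convOp ha u ≤ convOp ha v := by
  rw [← Lp.coeFn_le] at h ⊢
  filter_upwards [coeFn_convOp ha u, coeFn_convOp ha v] with x hu hv
  rw [hu, hv]
  exact conv_mono ha (Lp.memLp u) (Lp.memLp v) h x

end Convolution

/-! ### Exponential formula and order bounds for linear evolution equations. -/

section Evolution

variable {E : Type*} [NormedAddCommGroup E] [NormedSpace ℝ E] [CompleteSpace E]

/-- A solution of a linear evolution equation with bounded generator is given by the exponential. -/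
theorem eq_exp_smul_of_hasDerivAt (L : E →L[ℝ] E) {w : ℝ → E} (hc : ContinuousOn w (Ici 0))
    (hd : ∀ t, 0 < t → HasDerivAt w (L (w t)) t) {t : ℝ} (ht : 0 ≤ t) :
    w t = NormedSpace.exp (t • L) (w 0) := by
  have hright : ∀ s, 0 ≤ s → HasDerivWithinAt w (L (w s)) (Ici s) s := by
    intro s hs
    rcases hs.eq_or_lt with rfl | hs
    -- The equation is only given for positive times; the right derivative at 0 is the limit of the
    -- derivatives.
    · refine hasDerivWithinAt_Ici_of_tendsto_deriv (s := Ioi 0)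
        (fun s hs => (hd s hs).differentiableAt.differentiableWithinAt)
        ((hc 0 self_mem_Ici).mono Ioi_subset_Ici_self) self_mem_nhdsWithin ?_
      refine Tendsto.congr' ?_ ((L.continuous.tendsto _).comp
        ((hc 0 self_mem_Ici).mono Ioi_subset_Ici_self))
      filter_upwards [self_mem_nhdsWithin] with s hs
      exact (hd s hs).deriv.symm
    · exact (hd s hs).hasDerivWithinAt
  have hexp (s : ℝ) : HasDerivAt (fun r : ℝ => NormedSpace.exp ((t - r) • L))
      (-(NormedSpace.exp ((t - s) • L) * L)) s := by
    have h1 : HasDerivAt (fun r : ℝ => t - r) (-1) s := by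
      simpa using (hasDerivAt_id s).const_sub t
    have h := (hasDerivAt_exp_smul_const (𝕂 := ℝ) L (t - s)).scomp s h1
    simp only [neg_smul, one_smul] at h
    exact h
  -- Duhamel's trick: `s ↦ exp((t - s)L) w(s)` is constant on `[0, t]`; its values at 0 and `t` are
  -- compared.
  have hconst := constant_of_has_deriv_right_zero
    (f := fun s => NormedSpace.exp ((t - s) • L) (w s)) (a := 0) (b := t)
    (ContinuousOn.clm_apply (fun s _ => (hexp s).continuousAt.continuousWithinAt)
      (hc.mono Icc_subset_Ici_self))
    (fun s hs => by
      have h := (hexp s).hasDerivWithinAt.clm_apply (hright s hs.1)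
      simpa using h)
    t (right_mem_Icc.2 ht)
  simpa [NormedSpace.exp_zero] using hconst

/-- The integrating factor `e^{mt}` removes the term `-m w`, so that for `κ ≥ 0` and positive `A`
only the exponential of a positive operator remains and its series can be compared term by term. -/
theorem eq_exp_mul_smul_exp_of_hasDerivAt (A : E →L[ℝ] E) (κ m : ℝ) {w : ℝ → E}
    (hc : ContinuousOn w (Ici 0))
    (hd : ∀ t, 0 < t → HasDerivAt w (κ • A (w t) - m • w t) t) {t : ℝ} (ht : 0 ≤ t) :
    w t = Real.exp (-(m * t)) • NormedSpace.exp ((κ * t) • A) (w 0) := by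
  have hreal (t : ℝ) : HasDerivAt (fun s => Real.exp (m * s)) (Real.exp (m * t) * m) t := by
    simpa using ((hasDerivAt_id t).const_mul m).exp
  have h := eq_exp_smul_of_hasDerivAt (κ • A) (w := fun s => Real.exp (m * s) • w s)
    (ContinuousOn.smul (fun s _ => (hreal s).continuousAt.continuousWithinAt) hc)
    (fun s hs => by
      refine ((hreal s).smul (hd s hs)).congr_deriv ?_
      rw [smul_apply, map_smul, smul_sub, smul_smul, smul_smul, smul_smul, mul_comm κ]
      abel) ht
  simp only [mul_zero, Real.exp_zero, one_smul, smul_smul] at h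
  rw [mul_comm κ, ← h, smul_smul, ← Real.exp_add]
  simp

/-- A positive operator that is subhomogeneous on `Ω` has an exponential with the same property. -/
theorem exp_smul_apply_le [PartialOrder E] [IsOrderedAddMonoid E] [OrderClosedTopology E]
    [PosSMulMono ℝ E] {A : E →L[ℝ] E} (hA : Monotone A) {u Ω : E} {γ r : ℝ} (hγ : 0 ≤ γ)
    (hr : 0 ≤ r) (hu : u ≤ Ω) (hΩ : A Ω ≤ γ • Ω) :
    NormedSpace.exp (r • A) u ≤ Real.exp (r * γ) • Ω := by
  have hpow (n : ℕ) : (A ^ n) u ≤ γ ^ n • Ω := by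
    induction n with
    | zero => simpa using hu
    | succ n ih =>
      rw [pow_succ', mul_apply_eq_comp, pow_succ, mul_smul]
      refine (hA ih).trans ?_
      rw [map_smul]
      exact smul_le_smul_of_nonneg_left hΩ (pow_nonneg hγ n)
  have h1 := (NormedSpace.exp_series_hasSum_exp' (𝕂 := ℝ) (r • A)).mapL
    (ContinuousLinearMap.apply ℝ E u)
  have h2 := (NormedSpace.exp_series_hasSum_exp' (𝕂 := ℝ) (r * γ)).smul_const Ω
  rw [← Real.exp_eq_exp_ℝ] at h2
  refine hasSum_le (fun n => ?_) h1 h2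
  simp only [ContinuousLinearMap.apply_apply, smul_apply, smul_pow, smul_smul, smul_eq_mul,
    mul_pow]
  rw [← mul_assoc, mul_smul _ (γ ^ n)]
  exact smul_le_smul_of_nonneg_left (hpow n) (by positivity)

end Evolution

/-! ### Comparison of solutions with supersolutions. -/

section Comparison

instance LInfty.posSMulMono (d : ℕ) : PosSMulMono ℝ (LInfty d) where
  smul_le_smul_of_nonneg_left r hr u v huv := by
    rw [← Lp.coeFn_le] at huv ⊢
    filter_upwards [huv, Lp.coeFn_smul r u, Lp.coeFn_smul r v] with x h h1 h2
    rw [h1, h2]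
    exact mul_le_mul_of_nonneg_left h hr

variable {d : ℕ} {a : Space d → ℝ} {κ m : ℝ} {u₀ : LInfty d} {w : ℝ → LInfty d}

theorem IsClassicalSolution.hasDerivAt (ha : IsBoundedProbabilityKernel a)
    (hw : IsClassicalSolution κ m a u₀ w) {t : ℝ} (ht : 0 < t) :
    HasDerivAt w (κ • convOp ha (w t) - m • w t) t := by
  have h : DifferentiableAt ℝ w t :=
    (hw.contDiffOn.differentiableOn one_ne_zero).differentiableAt (Ioi_mem_nhds ht)
  refine h.hasDerivAt.congr_deriv (Lp.ext ?_)
  filter_upwards [hw.equation t ht, coeFn_convOp ha (w t),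
    Lp.coeFn_sub (κ • convOp ha (w t)) (m • w t), Lp.coeFn_smul κ (convOp ha (w t)),
    Lp.coeFn_smul m (w t)] with x h1 h2 h3 h4 h5
  rw [h1, h3, Pi.sub_apply, h4, h5, Pi.smul_apply, Pi.smul_apply, h2, smul_eq_mul, smul_eq_mul]

/-- Comparison of a classical solution with a bounded supersolution of the eigenvalue problem. -/
theorem IsClassicalSolution.ae_le_of_conv_le (ha : IsBoundedProbabilityKernel a)
    (hw : IsClassicalSolution κ m a u₀ w) (hκ : 0 ≤ κ) {ω : Space d → ℝ}
    (hω : MemLp ω ∞ volume) {γ : ℝ} (hγ : 0 ≤ γ) (hconv : ∀ᵐ x, conv a ω x ≤ γ * ω x)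
    (hu : ∀ᵐ x, u₀ x ≤ ω x) {t : ℝ} (ht : 0 ≤ t) :
    ∀ᵐ x, w t x ≤ Real.exp ((κ * γ - m) * t) * ω x := by
  set Ω : LInfty d := hω.toLp ω
  have hΩ := hω.coeFn_toLp
  have hu' : u₀ ≤ Ω := by
    rw [← Lp.coeFn_le]
    filter_upwards [hu, hΩ] with x h1 h2
    rwa [h2]
  have hA : convOp ha Ω ≤ γ • Ω := by
    rw [← Lp.coeFn_le]
    filter_upwards [hconv, hΩ, coeFn_convOp ha Ω, Lp.coeFn_smul γ Ω] with x h1 h2 h3 h4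
    rw [h3, h4, conv_congr hΩ, Pi.smul_apply, h2]
    exact h1
  have key : w t ≤ Real.exp ((κ * γ - m) * t) • Ω := by
    rw [eq_exp_mul_smul_exp_of_hasDerivAt (convOp ha) κ m hw.continuousOn
      (fun s hs => hw.hasDerivAt ha hs) ht, hw.initial,
      show (κ * γ - m) * t = -(m * t) + κ * t * γ by ring, Real.exp_add, mul_smul _ _ Ω]
    have hmono : Monotone (convOp ha) := fun _ _ h => convOp_mono ha h
    have hexp := exp_smul_apply_le hmono hγ (mul_nonneg hκ ht) hu' hA
    exact smul_le_smul_of_nonneg_left hexp (Real.exp_pos _).le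
  rw [← Lp.coeFn_le] at key
  filter_upwards [key, hΩ, Lp.coeFn_smul (Real.exp ((κ * γ - m) * t)) Ω] with x h1 h2 h3
  rwa [h3, Pi.smul_apply, h2] at h1

end Comparison

/-! ### Powers of a heavy-tailed profile as supersolutions. -/

section Supersolution

variable {d : ℕ} {a : Space d → ℝ} {f : ℝ → ℝ}

theorem conv_eq_integral_sub (a v : Space d → ℝ) (x : Space d) :
    conv a v x = ∫ y, a y * v (x - y) := by
  rw [← integral_sub_left_eq_self (fun y => a y * v (x - y)) volume x]
  simp only [conv, sub_sub_cancel]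

theorem measurable_antitone_norm_rpow (hf : Antitone f) (α : ℝ) :
    Measurable fun x : Space d => f ‖x‖ ^ α :=
  (hf.measurable.comp measurable_norm).pow_const α

theorem rpow_le_one_of_mem_Ioc (hpos : ∀ s, 0 < f s) (hone : ∀ s, f s ≤ 1) {α : ℝ} (hα : 0 ≤ α)
    (s : ℝ) : f s ^ α ≤ 1 :=
  Real.rpow_le_one (hpos s).le (hone s) hα

theorem memLp_top_of_measurable_of_le {v : Space d → ℝ} (hv : Measurable v) {K : ℝ}
    (h0 : ∀ x, 0 ≤ v x) (hK : ∀ x, v x ≤ K) : MemLp v ∞ volume :=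
  memLp_top_of_bound hv.aestronglyMeasurable K
    (ae_of_all _ fun x => by rw [Real.norm_of_nonneg (h0 x)]; exact hK x)

theorem memLp_top_norm_rpow (hf : Antitone f) (hpos : ∀ s, 0 < f s) (hone : ∀ s, f s ≤ 1)
    {α : ℝ} (hα : 0 ≤ α) : MemLp (fun x : Space d => f ‖x‖ ^ α) ∞ volume :=
  memLp_top_of_measurable_of_le (measurable_antitone_norm_rpow hf α)
    (fun _ => (Real.rpow_pos_of_pos (hpos _) α).le)
    (fun _ => rpow_le_one_of_mem_Ioc hpos hone hα _)

/-- Splitting the convolution according to whether the jump is at most `H`, at least `‖x‖ - H`,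
or intermediate. -/
theorem conv_norm_rpow_le (ha : IsBoundedProbabilityKernel a) (hf : Antitone f)
    (hpos : ∀ s, 0 < f s) (hone : ∀ s, f s ≤ 1) {α α₂ C H : ℝ} (hα : 0 ≤ α) (hα₂ : α ≤ α₂)
    (hC : 0 ≤ C) (hH : 0 ≤ H) (haf : ∀ᵐ x, a x ≤ C * f ‖x‖ ^ α₂)
    (hint : Integrable fun y : Space d => f ‖y‖ ^ α) (x : Space d)
    (hlc : ∀ u, H ≤ u → u ≤ ‖x‖ - H → f u * f (‖x‖ - u) ≤ f H * f (‖x‖ - H)) :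
    conv a (fun y => f ‖y‖ ^ α) x ≤ f (‖x‖ - H) ^ α *
      (1 + C * f (‖x‖ - H) ^ (α₂ - α) * (∫ y : Space d, f ‖y‖ ^ α) +
        C * (f H ^ α * ∫ y in Metric.ball (0 : Space d) ‖x‖, f ‖y‖ ^ (α₂ - α))) := by
  set s := ‖x‖ with hs
  set p := f (s - H) with hp
  have hp0 : 0 < p := hpos _
  have hW0 (y : Space d) : 0 < f ‖y‖ ^ α := Real.rpow_pos_of_pos (hpos _) α
  have hI1 : Integrable fun y : Space d => p ^ α * a y := ha.integrable.const_mul _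
  have hI2 : Integrable fun y : Space d => C * p ^ α₂ * f ‖x - y‖ ^ α :=
    (hint.comp_sub_left x).const_mul _
  have hI3' : IntegrableOn (fun y : Space d => f ‖y‖ ^ (α₂ - α)) (Metric.ball 0 s) := by
    refine Measure.integrableOn_of_bounded (M := 1) Metric.isBounded_ball.measure_lt_top.ne
      (measurable_antitone_norm_rpow hf _).aestronglyMeasurable (ae_of_all _ fun y => ?_)
    rw [Real.norm_of_nonneg (Real.rpow_pos_of_pos (hpos _) _).le]
    exact rpow_le_one_of_mem_Ioc hpos hone (by linarith) _
  have hI3 : Integrable ((Metric.ball (0 : Space d) s).indicator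
      fun y => C * f H ^ α * p ^ α * f ‖y‖ ^ (α₂ - α)) :=
    (integrable_indicator_iff Metric.isOpen_ball.measurableSet).2 (hI3'.const_mul _)
  have hbound : ∀ᵐ y, a y * f ‖x - y‖ ^ α ≤ p ^ α * a y + C * p ^ α₂ * f ‖x - y‖ ^ α +
      (Metric.ball (0 : Space d) s).indicator
        (fun y => C * f H ^ α * p ^ α * f ‖y‖ ^ (α₂ - α)) y := by
    filter_upwards [haf, ha.nonneg] with y hay hay0
    have hx : s ≤ ‖y‖ + ‖x - y‖ := by
      have := norm_add_le y (x - y)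
      rwa [add_sub_cancel] at this
    have hWxy := hW0 (x - y)
    have t1 : 0 ≤ p ^ α * a y := by positivity
    have t2 : 0 ≤ C * p ^ α₂ * f ‖x - y‖ ^ α := by positivity
    have t3 : 0 ≤ (Metric.ball (0 : Space d) s).indicator
        (fun y => C * f H ^ α * p ^ α * f ‖y‖ ^ (α₂ - α)) y := by
      refine indicator_nonneg (fun y _ => ?_) y
      have := hpos H
      have := hpos ‖y‖
      positivity
    rcases le_total ‖y‖ H with h1 | h1
    · have : f ‖x - y‖ ^ α ≤ p ^ α :=
        Real.rpow_le_rpow (hpos _).le (hf (by linarith)) hα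
      nlinarith
    rcases le_total (s - H) ‖y‖ with h2 | h2
    · have : f ‖y‖ ^ α₂ ≤ p ^ α₂ :=
        Real.rpow_le_rpow (hpos _).le (hf h2) (hα.trans hα₂)
      have : a y ≤ C * p ^ α₂ := hay.trans (mul_le_mul_of_nonneg_left this hC)
      nlinarith
    -- The boundary case is treated as a long jump: since `H` may be 0, strict inequality is what
    -- places `y` in the open ball.
    · rcases h2.eq_or_lt with h2e | h2
      · have : a y ≤ C * p ^ α₂ := by rw [hp, ← h2e]; exact hay
        nlinarith
      have hmem : y ∈ Metric.ball (0 : Space d) s := by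
        rw [mem_ball_zero_iff]; linarith
      rw [indicator_of_mem hmem]
      have hprod : f ‖y‖ ^ α * f ‖x - y‖ ^ α ≤ f H ^ α * p ^ α := by
        rw [← Real.mul_rpow (hpos _).le (hpos _).le, ← Real.mul_rpow (hpos _).le (hpos _).le]
        refine Real.rpow_le_rpow (mul_pos (hpos _) (hpos _)).le ?_ hα
        exact (mul_le_mul_of_nonneg_left (hf (by linarith)) (hpos _).le).trans (hlc _ h1 h2.le)
      have hsplit : f ‖y‖ ^ α₂ = f ‖y‖ ^ (α₂ - α) * f ‖y‖ ^ α := by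
        rw [← Real.rpow_add (hpos _), sub_add_cancel]
      have hq : 0 ≤ C * f ‖y‖ ^ (α₂ - α) := mul_nonneg hC (Real.rpow_pos_of_pos (hpos _) _).le
      have h3 : a y * f ‖x - y‖ ^ α ≤ C * f H ^ α * p ^ α * f ‖y‖ ^ (α₂ - α) := calc
        a y * f ‖x - y‖ ^ α ≤ C * f ‖y‖ ^ α₂ * f ‖x - y‖ ^ α :=
          mul_le_mul_of_nonneg_right hay hWxy.le
        _ = C * f ‖y‖ ^ (α₂ - α) * (f ‖y‖ ^ α * f ‖x - y‖ ^ α) := by rw [hsplit]; ring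
        _ ≤ C * f ‖y‖ ^ (α₂ - α) * (f H ^ α * p ^ α) := mul_le_mul_of_nonneg_left hprod hq
        _ = _ := by ring
      linarith
  have hI0 : Integrable fun y => a y * f ‖x - y‖ ^ α := by
    simpa only [sub_sub_cancel] using
      (ha.integrable_conv_integrand (memLp_top_norm_rpow hf hpos hone hα) x).comp_sub_left x
  have hsplit : p ^ α₂ = p ^ α * p ^ (α₂ - α) := by
    rw [← Real.rpow_add hp0, add_sub_cancel]
  rw [conv_eq_integral_sub]
  have hI12 : Integrable fun y => p ^ α * a y + C * p ^ α₂ * f ‖x - y‖ ^ α := hI1.add hI2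
  refine (integral_mono_ae hI0 (hI12.add hI3) hbound).trans_eq ?_
  rw [integral_add' hI12 hI3, integral_add hI1 hI2, integral_const_mul, integral_const_mul,
    integral_indicator Metric.isOpen_ball.measurableSet, integral_const_mul, ha.integral_eq_one,
    integral_sub_left_eq_self (fun y : Space d => f ‖y‖ ^ α) volume x, hsplit]
  ring

/-- Use the splitting with `H = h s`: the short-jump factor tends to 1 by insensitivity to shifts by
`h`, and the other two contributions tend to 0, so the total factor is eventually below any `γ > 1`.
-/
theorem eventually_conv_norm_rpow_le (ha : IsBoundedProbabilityKernel a) (hf : Antitone f)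
    (hpos : ∀ s, 0 < f s) (hone : ∀ s, f s ≤ 1) (hf0 : Tendsto f atTop (𝓝 0))
    {α α₂ C ρ : ℝ} (hα : 0 ≤ α) (hα₂ : α < α₂)
    (hC : 0 ≤ C) (haf : ∀ᵐ x, a x ≤ C * f ‖x‖ ^ α₂)
    (hint : Integrable fun y : Space d => f ‖y‖ ^ α)
    (hlc : ∀ H u s, ρ < H → H ≤ u → u ≤ s - H → f u * f (s - u) ≤ f H * f (s - H))
    {h : ℝ → ℝ} (hh : Tendsto h atTop atTop) (hsub : Tendsto (fun s => s - h s) atTop atTop)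
    (hins : Tendsto (fun s => f (s - h s) / f s) atTop (𝓝 1))
    (hJ : Tendsto (fun s => f (h s) ^ α *
      ∫ y in Metric.ball (0 : Space d) s, f ‖y‖ ^ (α₂ - α)) atTop (𝓝 0))
    {γ : ℝ} (hγ : 1 < γ) :
    ∀ᶠ s in atTop, ∀ x : Space d, ‖x‖ = s →
      conv a (fun y => f ‖y‖ ^ α) x ≤ γ * f ‖x‖ ^ α := by
  have hlim : Tendsto (fun s => (f (s - h s) / f s) ^ α *
      (1 + C * f (s - h s) ^ (α₂ - α) * (∫ y : Space d, f ‖y‖ ^ α) +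
        C * (f (h s) ^ α * ∫ y in Metric.ball (0 : Space d) s, f ‖y‖ ^ (α₂ - α))))
      atTop (𝓝 (1 ^ α * (1 + C * 0 ^ (α₂ - α) * (∫ y : Space d, f ‖y‖ ^ α) + C * 0))) := by
    refine (hins.rpow_const (Or.inr hα)).mul ((tendsto_const_nhds.add ?_).add (hJ.const_mul C))
    exact (((hf0.comp hsub).rpow_const (Or.inr (by linarith))).const_mul C).mul_const _
  rw [Real.zero_rpow (by linarith), Real.one_rpow] at hlim
  simp only [mul_zero, zero_mul, add_zero, mul_one] at hlim
  filter_upwards [hlim.eventually_lt_const hγ, hh.eventually_gt_atTop ρ, hh.eventually_ge_atTop 0]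
    with s hs hρ h0 x hx
  have key := conv_norm_rpow_le ha hf hpos hone hα hα₂.le hC h0 haf hint x
    (fun u h1 h2 => hlc _ _ _ hρ h1 h2)
  rw [hx] at key ⊢
  refine key.trans ?_
  rw [Real.div_rpow (hpos _).le (hpos _).le, div_mul_eq_mul_div,
    div_lt_iff₀ (Real.rpow_pos_of_pos (hpos _) _)] at hs
  exact hs.le

/-- Flattening near the origin turns an asymptotic supersolution into a global one. -/
theorem exists_conv_max_norm_rpow_le (ha : IsBoundedProbabilityKernel a) (hf : Antitone f)
    (hpos : ∀ s, 0 < f s) (hone : ∀ s, f s ≤ 1) {α γ : ℝ} (hα : 0 ≤ α) (hγ : 1 ≤ γ)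
    (hev : ∀ᶠ s in atTop, ∀ x : Space d, ‖x‖ = s →
      conv a (fun y => f ‖y‖ ^ α) x ≤ γ * f ‖x‖ ^ α) :
    ∃ R : ℝ, 0 ≤ R ∧ ∀ x : Space d,
      conv a (fun y => f (max ‖y‖ R) ^ α) x ≤ γ * f (max ‖x‖ R) ^ α := by
  obtain ⟨R, hR⟩ := eventually_atTop.1 hev
  refine ⟨max R 0, le_max_right _ _, fun x => ?_⟩
  set S := max R 0
  have hf' : Antitone fun s => f (max s S) := fun s t hst => hf (max_le_max_right _ hst)
  have hm : MemLp (fun y : Space d => f (max ‖y‖ S) ^ α) ∞ volume :=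
    memLp_top_norm_rpow (f := fun s => f (max s S)) hf' (fun _ => hpos _) (fun _ => hone _) hα
  have hpw (s : ℝ) : 0 < f s ^ α := Real.rpow_pos_of_pos (hpos _) α
  -- The flattened function is the minimum of the constant `f S ^ α` and `f ‖x‖ ^ α`. Each satisfies
  -- the inequality where it attains the minimum, the constant because `γ ≥ 1`.
  rcases le_total ‖x‖ S with hx | hx
  · rw [max_eq_right hx]
    refine le_trans ?_ (le_mul_of_one_le_left (hpw _).le hγ)
    refine (conv_mono ha hm (memLp_top_const _) (ae_of_all _ fun y => ?_) x).trans_eq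
      (conv_const ha (f S ^ α) x)
    exact Real.rpow_le_rpow (hpos _).le (hf (le_max_right _ _)) hα
  · rw [max_eq_left hx]
    refine le_trans (conv_mono ha hm (memLp_top_norm_rpow hf hpos hone hα)
      (ae_of_all _ fun y => ?_) x) (hR ‖x‖ ((le_max_left _ _).trans hx) x rfl)
    exact Real.rpow_le_rpow (hpos _).le (hf (le_max_left _ _)) hα

/-- The integrand is at most 1, so the integral is at most the volume of the ball, of order `s ^ d`.
-/
theorem tendsto_mul_setIntegral_ball_of_tendsto_mul_pow
    (hpos : ∀ s, 0 < f s) (hone : ∀ s, f s ≤ 1) {α η : ℝ} (hη : 0 ≤ η) {h : ℝ → ℝ}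
    (hlim : Tendsto (fun s => f (h s) ^ α * s ^ d) atTop (𝓝 0)) :
    Tendsto (fun s => f (h s) ^ α * ∫ y in Metric.ball (0 : Space d) s, f ‖y‖ ^ η)
      atTop (𝓝 0) := by
  set V := volume.real (Metric.ball (0 : Space d) 1)
  have hub := hlim.mul_const V
  rw [zero_mul] at hub
  refine tendsto_of_tendsto_of_tendsto_of_le_of_le' tendsto_const_nhds hub
    (Eventually.of_forall fun s => ?_) ?_
  · exact mul_nonneg (Real.rpow_pos_of_pos (hpos _) _).le
      (integral_nonneg fun y => (Real.rpow_pos_of_pos (hpos _) _).le)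
  filter_upwards [eventually_gt_atTop 0] with s hs
  rw [mul_assoc]
  refine mul_le_mul_of_nonneg_left ?_ (Real.rpow_pos_of_pos (hpos _) _).le
  have hb : ∀ y ∈ Metric.ball (0 : Space d) s, ‖f ‖y‖ ^ η‖ ≤ 1 := fun y _ => by
    rw [Real.norm_of_nonneg (Real.rpow_pos_of_pos (hpos _) _).le]
    exact rpow_le_one_of_mem_Ioc hpos hone hη _
  have h1 := norm_setIntegral_le_of_norm_le_const (μ := volume)
    (Metric.isBounded_ball (x := (0 : Space d)) (r := s)).measure_lt_top hb
  refine (le_abs_self _).trans (h1.trans_eq ?_)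
  rw [one_mul, Measure.real, Measure.addHaar_ball_of_pos _ _ hs, ENNReal.toReal_mul,
    ENNReal.toReal_ofReal (by positivity)]
  simp [V, Measure.real]

theorem tendsto_mul_setIntegral_ball_of_integrable (hpos : ∀ s, 0 < f s)
    (hf0 : Tendsto f atTop (𝓝 0)) {α η : ℝ} (hα : 0 < α)
    {h : ℝ → ℝ} (hh : Tendsto h atTop atTop) (hint : Integrable fun y : Space d => f ‖y‖ ^ η) :
    Tendsto (fun s => f (h s) ^ α * ∫ y in Metric.ball (0 : Space d) s, f ‖y‖ ^ η)
      atTop (𝓝 0) := by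
  have hub := ((hf0.comp hh).rpow_const (p := α) (Or.inr hα.le)).mul_const
    (∫ y : Space d, f ‖y‖ ^ η)
  rw [Real.zero_rpow hα.ne', zero_mul] at hub
  have hnn (y : Space d) : 0 ≤ f ‖y‖ ^ η := (Real.rpow_pos_of_pos (hpos _) _).le
  refine tendsto_of_tendsto_of_tendsto_of_le_of_le tendsto_const_nhds hub (fun s => ?_)
    fun s => ?_
  · exact mul_nonneg (Real.rpow_pos_of_pos (hpos _) _).le (integral_nonneg hnn)
  · exact mul_le_mul_of_nonneg_left (setIntegral_le_integral hint (ae_of_all _ hnn))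
      (Real.rpow_pos_of_pos (hpos _) _).le

end Supersolution

/-! ### Abstract tail profiles and decay estimates. -/

section Profile

variable {d : ℕ} {b f : ℝ → ℝ}

/-- Nonincreasing regular heavy-tailed profiles, with the properties that make small powers of them
asymptotic supersolutions. -/
structure TailProfile (d : ℕ) (f : ℝ → ℝ) (α₀ : ℝ) : Prop where
  antitone : Antitone f
  pos : ∀ s, 0 < f s
  le_one : ∀ s, f s ≤ 1
  tendsto_zero : Tendsto f atTop (𝓝 0)
  mul_le_mul : ∃ ρ : ℝ, ∀ H u s, ρ < H → H ≤ u → u ≤ s - H → f u * f (s - u) ≤ f H * f (s - H)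
  exponent_pos : 0 < α₀
  exponent_lt_one : α₀ < 1
  integrable : Integrable fun y : Space d => f ‖y‖ ^ α₀
  -- The cut-off `h` must grow slowly enough for `f` not to feel a shift by it, yet fast enough to
  -- suppress the intermediate jumps.
  exists_window : ∀ α α₂ : ℝ, α₀ ≤ α → α < α₂ → ∃ h : ℝ → ℝ, Tendsto h atTop atTop ∧
    Tendsto (fun s => s - h s) atTop atTop ∧
    Tendsto (fun s => f (s - h s) / f s) atTop (𝓝 1) ∧
    Tendsto (fun s => f (h s) ^ α * ∫ y in Metric.ball (0 : Space d) s, f ‖y‖ ^ (α₂ - α))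
      atTop (𝓝 0)

theorem TailProfile.integrable_rpow {α₀ : ℝ} (hf : TailProfile d f α₀) {α : ℝ} (hα : α₀ ≤ α) :
    Integrable fun y : Space d => f ‖y‖ ^ α := by
  refine hf.integrable.mono' (measurable_antitone_norm_rpow hf.antitone α).aestronglyMeasurable
    (ae_of_all _ fun y => ?_)
  rw [Real.norm_of_nonneg (Real.rpow_pos_of_pos (hf.pos _) _).le]
  exact Real.rpow_le_rpow_of_exponent_ge (hf.pos _) (hf.le_one _) hα

theorem TailProfile.exists_supersolution {a : Space d → ℝ} {α₀ α α₂ C γ : ℝ}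
    (hf : TailProfile d f α₀) (ha : IsBoundedProbabilityKernel a) (hα : α₀ ≤ α) (hα₂ : α < α₂)
    (hC : 0 ≤ C) (haf : ∀ᵐ x, a x ≤ C * f ‖x‖ ^ α₂) (hγ : 1 < γ) :
    ∃ R : ℝ, 0 ≤ R ∧ ∀ x : Space d,
      conv a (fun y => f (max ‖y‖ R) ^ α) x ≤ γ * f (max ‖x‖ R) ^ α := by
  obtain ⟨ρ, hρ⟩ := hf.mul_le_mul
  obtain ⟨h, h1, h2, h3, h4⟩ := hf.exists_window α α₂ hα hα₂
  have hα' : 0 ≤ α := hf.exponent_pos.le.trans hα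
  exact exists_conv_max_norm_rpow_le ha hf.antitone hf.pos hf.le_one hα' hγ.le
    (eventually_conv_norm_rpow_le ha hf.antitone hf.pos hf.le_one hf.tendsto_zero hα' hα₂ hC haf
      (hf.integrable_rpow hα) hρ h1 h2 h3 h4 hγ)

theorem integrable_norm_rpow_of_tendsto (hf : Antitone f) (hpos : ∀ s, 0 < f s)
    (hone : ∀ s, f s ≤ 1) {p α : ℝ} (hα : 0 < α) (hpα : d < p * α)
    (hlim : Tendsto (fun s => f s * s ^ p) atTop (𝓝 0)) :
    Integrable fun y : Space d => f ‖y‖ ^ α := by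
  have hp : 0 < p := by
    by_contra! h
    have : p * α ≤ 0 := mul_nonpos_of_nonpos_of_nonneg h hα.le
    have : (0 : ℝ) ≤ d := Nat.cast_nonneg d
    linarith
  obtain ⟨S, hS⟩ := eventually_atTop.1
    ((hlim.eventually_lt_const one_pos).and (eventually_ge_atTop 1))
  set T := max S 1
  -- The first summand covers `s ≤ T`, where `f ≤ 1`; the second covers `s ≥ T ≥ 1`, where `1 + s ≤
  -- 2s` and `f s * s ^ p < 1`.
  have hb (s : ℝ) (hs : 0 ≤ s) : f s * (1 + s) ^ p ≤ (1 + T) ^ p + 2 ^ p := by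
    have h2 : (0 : ℝ) ≤ 2 ^ p := by positivity
    have hT : (0 : ℝ) ≤ (1 + T) ^ p := by positivity
    rcases le_total s T with h | h
    · have : (1 + s) ^ p ≤ (1 + T) ^ p := Real.rpow_le_rpow (by linarith) (by linarith) hp.le
      have h0 : (0 : ℝ) ≤ (1 + s) ^ p := by positivity
      nlinarith [hone s, hpos s]
    · obtain ⟨h3, h4⟩ := hS s ((le_max_left _ _).trans h)
      have : (1 + s) ^ p ≤ 2 ^ p * s ^ p := by
        rw [← Real.mul_rpow two_pos.le hs]
        exact Real.rpow_le_rpow (by linarith) (by linarith) hp.le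
      have := mul_le_mul_of_nonneg_left this (hpos s).le
      nlinarith
  have hfin : (Module.finrank ℝ (Space d) : ℝ) < p * α := by simpa using hpα
  refine ((integrable_one_add_norm hfin).const_mul (((1 + T) ^ p + 2 ^ p) ^ α)).mono'
    (measurable_antitone_norm_rpow hf α).aestronglyMeasurable (ae_of_all _ fun y => ?_)
  rw [Real.norm_of_nonneg (Real.rpow_pos_of_pos (hpos _) _).le]
  have h1 : (0 : ℝ) < 1 + ‖y‖ := by positivity
  rw [Real.rpow_neg h1.le, ← div_eq_mul_inv, le_div_iff₀ (by positivity), Real.rpow_mul h1.le,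
    ← Real.mul_rpow (hpos _).le (by positivity)]
  exact Real.rpow_le_rpow (mul_nonneg (hpos _).le (by positivity)) (hb _ (norm_nonneg y)) hα.le

theorem tendsto_rpow_mul_pow_of_tendsto (hpos : ∀ s, 0 < f s) {q α : ℝ} (hα : 0 < α)
    (hqα : d ≤ q * α) {h : ℝ → ℝ} (hlim : Tendsto (fun s => f (h s) * s ^ q) atTop (𝓝 0)) :
    Tendsto (fun s => f (h s) ^ α * s ^ d) atTop (𝓝 0) := by
  have hub := hlim.rpow_const (p := α) (Or.inr hα.le)
  rw [Real.zero_rpow hα.ne'] at hub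
  refine tendsto_of_tendsto_of_tendsto_of_le_of_le' tendsto_const_nhds hub ?_ ?_
  · filter_upwards [eventually_ge_atTop 0] with s hs
    exact mul_nonneg (Real.rpow_pos_of_pos (hpos _) _).le (by positivity)
  · filter_upwards [eventually_ge_atTop 1] with s hs
    have h0 : (0 : ℝ) ≤ s := by linarith
    rw [Real.mul_rpow (hpos _).le (by positivity), ← Real.rpow_mul h0, ← Real.rpow_natCast]
    exact mul_le_mul_of_nonneg_left (Real.rpow_le_rpow_of_exponent_le hs hqα)
      (Real.rpow_pos_of_pos (hpos _) _).le

/-- `u` and `s - u` are convex combinations of `H` and `s - H` with swapped weights; the two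
convexity inequalities add up to the claim. -/
theorem mul_le_mul_of_convexOn_log {ρ : ℝ} (hc : TailLogConvexFrom ρ f)
    (hpos : ∀ s, ρ < s → 0 < f s) {H u s : ℝ} (hH : ρ < H) (hu : H ≤ u) (hus : u ≤ s - H) :
    f u * f (s - u) ≤ f H * f (s - H) := by
  rcases hu.eq_or_lt with rfl | hu
  · exact le_rfl
  have hHm : H ∈ Ioi ρ := hH
  have hsm : s - H ∈ Ioi ρ := by rw [mem_Ioi]; linarith
  have hD : 0 < s - H - H := by linarith
  set θ := (u - H) / (s - H - H) with hθ
  have hθ0 : 0 ≤ θ := div_nonneg (by linarith) hD.le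
  have hθ1 : 0 ≤ 1 - θ := by
    rw [sub_nonneg, hθ, div_le_one hD]; linarith
  have hθD : θ * (s - H - H) = u - H := div_mul_cancel₀ _ hD.ne'
  have h1 := hc.2 hHm hsm hθ1 hθ0 (by ring)
  have h2 := hc.2 hHm hsm hθ0 hθ1 (by ring)
  simp only [smul_eq_mul] at h1 h2
  rw [show (1 - θ) * H + θ * (s - H) = u by linear_combination hθD] at h1
  rw [show θ * H + (1 - θ) * (s - H) = s - u by linear_combination -hθD] at h2
  have p1 := hpos u (by linarith)
  have p2 := hpos (s - u) (by linarith)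
  have p3 := hpos H hH
  have p4 := hpos (s - H) hsm
  rw [← Real.log_le_log_iff (mul_pos p1 p2) (mul_pos p3 p4), Real.log_mul p1.ne' p2.ne',
    Real.log_mul p3.ne' p4.ne']
  linarith

theorem tendsto_sub_rpow_atTop {θ : ℝ} (hθ : θ < 1) :
    Tendsto (fun s : ℝ => s - s ^ θ) atTop atTop := by
  have h0 : Tendsto (fun s : ℝ => 1 - s ^ (-(1 - θ))) atTop (𝓝 1) := by
    simpa using (tendsto_rpow_neg_atTop (by linarith : 0 < 1 - θ)).const_sub 1
  refine (tendsto_id.atTop_mul_pos one_pos h0).congr' ?_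
  filter_upwards [eventually_gt_atTop 0] with s hs
  rw [id, mul_sub, mul_one]
  congr 1
  rw [show θ = 1 + -(1 - θ) by ring, Real.rpow_add hs, Real.rpow_one]
  ring_nf

theorem tendsto_polynomial_shift {θ M p : ℝ} (hθ : θ < 1) (hM : M ≠ 0) (hp : 0 ≤ p) :
    Tendsto (fun s : ℝ => (M / (1 + (s - s ^ θ)) ^ p) / (M / (1 + s) ^ p)) atTop (𝓝 1) := by
  have h0 : Tendsto (fun s : ℝ => s ^ θ / (1 + (s - s ^ θ))) atTop (𝓝 0) := by
    have h1 : Tendsto (fun s : ℝ => s ^ (-(1 - θ))) atTop (𝓝 0) :=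
      tendsto_rpow_neg_atTop (by linarith : 0 < 1 - θ)
    have h2 : Tendsto (fun s : ℝ => s⁻¹ + (1 - s ^ (-(1 - θ)))) atTop (𝓝 1) := by
      simpa using tendsto_inv_atTop_zero.add (h1.const_sub 1)
    have h3 := h1.div h2 one_ne_zero
    rw [zero_div] at h3
    refine h3.congr' ?_
    filter_upwards [eventually_gt_atTop 0] with s hs
    have e : s ^ (-(1 - θ)) = s ^ θ / s := by
      rw [show -(1 - θ) = θ - 1 by ring, Real.rpow_sub_one hs.ne']
    simp only [Pi.div_apply]
    rw [e, show s⁻¹ + (1 - s ^ θ / s) = (1 + (s - s ^ θ)) / s by field_simp,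
      div_div_div_cancel_right₀ hs.ne']
  have h1 := ((h0.const_add 1).rpow_const (p := p) (Or.inr hp))
  rw [add_zero, Real.one_rpow] at h1
  refine h1.congr' ?_
  filter_upwards [(tendsto_sub_rpow_atTop hθ).eventually_gt_atTop 0, eventually_gt_atTop 0]
    with s hs hs0
  have hpos : 0 < 1 + (s - s ^ θ) := by linarith
  rw [show 1 + s ^ θ / (1 + (s - s ^ θ)) = (1 + s) / (1 + (s - s ^ θ)) by field_simp; ring,
    Real.div_rpow (by linarith) hpos.le]
  have : (0 : ℝ) < (1 + s) ^ p := by positivity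
  have : (0 : ℝ) < (1 + (s - s ^ θ)) ^ p := by positivity
  field_simp

end Profile

/-! ### Tail profiles from regular heavy-tailed functions. -/

section ClassEProfile

variable {d : ℕ} {b f : ℝ → ℝ}

theorem exists_exponent_lt_one {p : ℝ} (hp : (d : ℝ) < p) :
    ∃ α₀ : ℝ, 0 < α₀ ∧ α₀ < 1 ∧ (d : ℝ) < p * α₀ := by
  have h0 : (0 : ℝ) ≤ d := Nat.cast_nonneg d
  have hp0 : 0 < p := h0.trans_lt hp
  have h1 : (d : ℝ) / p < 1 := (div_lt_one hp0).2 hp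
  have h2 : 0 ≤ (d : ℝ) / p := by positivity
  refine ⟨((d : ℝ) / p + 1) / 2, by linarith, by linarith, ?_⟩
  have h3 : p * ((d : ℝ) / p) = d := mul_div_cancel₀ _ hp0.ne'
  nlinarith

theorem tendsto_polynomial_mul_rpow {p q M : ℝ} (hpq : p < q) (hq : 0 ≤ q) (hM : 0 ≤ M) :
    Tendsto (fun s : ℝ => M / (1 + s) ^ q * s ^ p) atTop (𝓝 0) := by
  have h := (tendsto_rpow_neg_atTop (sub_pos.2 hpq)).const_mul M
  rw [mul_zero] at h
  refine tendsto_of_tendsto_of_tendsto_of_le_of_le' tendsto_const_nhds h ?_ ?_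
  · filter_upwards [eventually_gt_atTop 0] with s hs
    positivity
  · filter_upwards [eventually_gt_atTop 0] with s hs
    rw [neg_sub, Real.rpow_sub hs, div_mul_eq_mul_div, ← mul_div_assoc]
    refine div_le_div_of_nonneg_left (by positivity) (by positivity) ?_
    exact Real.rpow_le_rpow hs.le (by linarith) hq

theorem ClassE.exists_tailProfile (hd : 1 ≤ d) (hb : ClassE d b) :
    ∃ (f : ℝ → ℝ) (α₀ : ℝ), TailProfile d f α₀ ∧ f =ᶠ[atTop] b ∧
      ∃ K : ℝ, 0 < K ∧ ∀ s, 0 ≤ s → b s ≤ K * f s ∧ f s ≤ K * b s := by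
  obtain ⟨ρ, hρ0, ⟨hanti, hb0⟩, hconv, hone⟩ := hb.tail
  obtain ⟨δ, hδ, -, h, -, hbd, hh, -, hminus, hint⟩ := hb.insensitive
  -- Freezing `b` on `[0, ρ]` makes it monotone and at most 1 everywhere, at the cost of a bounded
  -- factor.
  set f : ℝ → ℝ := fun s => b (max s ρ) with hf
  have hfb {s : ℝ} (hs : ρ ≤ s) : f s = b s := by simp only [hf, max_eq_left hs]
  have hev : f =ᶠ[atTop] b := by
    filter_upwards [eventually_ge_atTop ρ] with s hs using hfb hs
  have hf_anti : Antitone f := fun s t hst =>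
    hanti.antitoneOn (le_max_right s ρ) (le_max_right t ρ) (max_le_max_right _ hst)
  have hf_pos (s : ℝ) : 0 < f s := hb.pos _ (hρ0.trans (le_max_right _ _))
  have hf_one (s : ℝ) : f s ≤ 1 :=
    (hanti.antitoneOn self_mem_Ici (le_max_right s ρ) (le_max_right s ρ)).trans hone
  have hf_zero : Tendsto f atTop (𝓝 0) := hb0.congr' hev.symm
  have hlc (H u s : ℝ) (h1 : ρ < H) (h2 : H ≤ u) (h3 : u ≤ s - H) :
      f u * f (s - u) ≤ f H * f (s - H) := by
    rw [hfb (by linarith), hfb (by linarith), hfb (by linarith), hfb (by linarith)]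
    exact mul_le_mul_of_convexOn_log hconv (fun s hs => hb.pos s (by linarith)) h1 h2 h3
  have hcomp : ∃ K : ℝ, 0 < K ∧ ∀ s, 0 ≤ s → b s ≤ K * f s ∧ f s ≤ K * b s := by
    obtain ⟨K, hK⟩ := hb.bounded
    obtain ⟨k, hk0, hk⟩ := hb.inf_pos (ρ + 1) (by linarith)
    have hbρ := hb.pos ρ hρ0
    refine ⟨max 1 (max (K / b ρ) (b ρ / k)), by positivity, fun s hs => ?_⟩
    set L := max 1 (max (K / b ρ) (b ρ / k))
    have hL1 : 1 ≤ L := le_max_left _ _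
    have hL2 : K / b ρ ≤ L := (le_max_left _ _).trans (le_max_right _ _)
    have hL3 : b ρ / k ≤ L := (le_max_right _ _).trans (le_max_right _ _)
    have hbs := hb.pos s hs
    rcases le_total ρ s with h | h
    · rw [hfb h]
      constructor <;> nlinarith
    · have : f s = b ρ := by simp only [hf, max_eq_right h]
      rw [this]
      rw [div_le_iff₀ hbρ] at hL2
      rw [div_le_iff₀ hk0] at hL3
      refine ⟨(hK s hs).trans hL2, hL3.trans ?_⟩
      exact mul_le_mul_of_nonneg_left (hk s hs (by linarith)) (by linarith)
  have hsub : Tendsto (fun s => s - h s) atTop atTop := by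
    refine tendsto_atTop_mono' atTop ?_ (tendsto_id.atTop_div_const (two_pos (α := ℝ)))
    filter_upwards [eventually_gt_atTop 0] with s hs
    have := (hbd s hs).2
    simp only [id]
    linarith
  have hratio {g : ℝ → ℝ} (hg : Tendsto (fun s => s - g s) atTop atTop)
      (hg' : Tendsto (fun s => b (s - g s) / b s) atTop (𝓝 1)) :
      Tendsto (fun s => f (s - g s) / f s) atTop (𝓝 1) := by
    refine hg'.congr' ?_
    filter_upwards [hg.eventually_ge_atTop ρ, eventually_ge_atTop ρ] with s h1 h2
    rw [hfb h1, hfb h2]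
  have hwindow {q α₀ : ℝ} (hα₀ : 0 < α₀) (hq : d ≤ q * α₀) {g : ℝ → ℝ} (hq0 : 0 ≤ q)
      (hlim : Tendsto (fun s => f (g s) * s ^ q) atTop (𝓝 0)) {α α₂ : ℝ} (h1 : α₀ ≤ α)
      (h2 : α < α₂) : Tendsto (fun s => f (g s) ^ α *
        ∫ y in Metric.ball (0 : Space d) s, f ‖y‖ ^ (α₂ - α)) atTop (𝓝 0) :=
    tendsto_mul_setIntegral_ball_of_tendsto_mul_pow hf_pos hf_one (by linarith)
      (tendsto_rpow_mul_pow_of_tendsto hf_pos (hα₀.trans_le h1) (hq.trans (by gcongr)) hlim)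
  have hfh : Tendsto (fun s => f (h s) * s ^ (1 + δ)) atTop (𝓝 0) := by
    refine hint.congr' ?_
    filter_upwards [hh.eventually_ge_atTop ρ] with s hs
    rw [hfb hs]
  suffices H : ∃ α₀ : ℝ, 0 < α₀ ∧ α₀ < 1 ∧ (Integrable fun y : Space d => f ‖y‖ ^ α₀) ∧
      ∀ α α₂ : ℝ, α₀ ≤ α → α < α₂ → ∃ h : ℝ → ℝ, Tendsto h atTop atTop ∧
        Tendsto (fun s => s - h s) atTop atTop ∧
        Tendsto (fun s => f (s - h s) / f s) atTop (𝓝 1) ∧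
        Tendsto (fun s => f (h s) ^ α * ∫ y in Metric.ball (0 : Space d) s, f ‖y‖ ^ (α₂ - α))
          atTop (𝓝 0) by
    obtain ⟨α₀, h1, h2, h3, h4⟩ := H
    exact ⟨f, α₀, ⟨hf_anti, hf_pos, hf_one, hf_zero, ⟨ρ, hlc⟩, h1, h2, h3, h4⟩, hev, hcomp⟩
  -- For `d = 1`, the decay `b(h(s)) s^{1+δ} → 0` already beats the length of the interval after
  -- raising to a power `α₀` with `(1 + δ)α₀ > 1`.
  rcases hd.eq_or_lt with rfl | hd
  · obtain ⟨α₀, h1, h2, h3⟩ := exists_exponent_lt_one (d := 1) (p := 1 + δ) (by push_cast; linarith)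
    refine ⟨α₀, h1, h2, integrable_norm_rpow_of_tendsto hf_anti hf_pos hf_one h1 h3 ?_,
      fun α α₂ h4 h5 => ⟨h, hh, hsub, hratio hsub hminus,
        hwindow h1 h3.le (by linarith) hfh h4 h5⟩⟩
    refine tendsto_of_tendsto_of_tendsto_of_le_of_le' tendsto_const_nhds hfh ?_ ?_
    · filter_upwards [eventually_gt_atTop 0] with s hs
      exact mul_nonneg (hf_pos s).le (by positivity)
    · filter_upwards [eventually_gt_atTop 0] with s hs
      have := (hbd s hs).2
      exact mul_le_mul_of_nonneg_right (hf_anti (by linarith)) (by positivity)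
  have hd0 : (0 : ℝ) < d := by exact_mod_cast (zero_lt_one.trans hd)
  rcases hb.multidim hd with ⟨μ, M, hμ, hM, hbM⟩ | hsuper
  · have hlim : Tendsto (fun s => f s * s ^ ((d : ℝ) + μ / 2)) atTop (𝓝 0) := by
      refine (tendsto_polynomial_mul_rpow (p := (d : ℝ) + μ / 2) (q := (d : ℝ) + μ) (M := M)
        (by linarith) (by linarith) hM.le).congr' ?_
      filter_upwards [hev, eventually_ge_atTop 0] with s hs hs0
      rw [hs, hbM s hs0]
    obtain ⟨α₀, h1, h2, h3⟩ := exists_exponent_lt_one (d := d) (p := (d : ℝ) + μ / 2)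
      (by linarith)
    have hp : 0 < (d : ℝ) + μ / 2 := by linarith
    -- For polynomial tails the window is replaced by `s ^ θ`. This `θ` solves `θ(d + μ/2)α₀ = d`,
    -- so `f(s^θ)^α` beats the ball volume, while `θ < 1` keeps the shift negligible.
    set θ := (d : ℝ) / (((d : ℝ) + μ / 2) * α₀) with hθ
    have hθ0 : 0 < θ := by positivity
    have hθ1 : θ < 1 := (div_lt_one (by positivity)).2 h3
    have hθ2 : (d : ℝ) ≤ θ * ((d : ℝ) + μ / 2) * α₀ := by
      rw [mul_assoc, hθ, div_mul_cancel₀ _ (by positivity)]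
    have hsub' := tendsto_sub_rpow_atTop hθ1
    refine ⟨α₀, h1, h2, integrable_norm_rpow_of_tendsto hf_anti hf_pos hf_one h1 h3 hlim,
      fun α α₂ h4 h5 => ⟨fun s => s ^ θ, tendsto_rpow_atTop hθ0, hsub', hratio hsub' ?_,
        hwindow h1 hθ2 (by positivity) ?_ h4 h5⟩⟩
    · refine (tendsto_polynomial_shift hθ1 hM.ne' (p := (d : ℝ) + μ) (by linarith)).congr' ?_
      filter_upwards [hsub'.eventually_ge_atTop 0, eventually_ge_atTop 0] with s h6 h7
      rw [hbM _ h6, hbM _ h7]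
    · refine (hlim.comp (tendsto_rpow_atTop hθ0)).congr' ?_
      filter_upwards [eventually_ge_atTop 0] with s hs
      rw [Function.comp_apply, Real.rpow_mul hs]
  · have hsuper' (ν : ℝ) (hν : 1 ≤ ν) : Tendsto (fun s => f s * s ^ ν) atTop (𝓝 0) := by
      refine (hsuper ν hν).congr' ?_
      filter_upwards [hev] with s hs
      rw [hs]
    obtain ⟨α₀, h1, h2, h3⟩ := exists_exponent_lt_one (d := d) (p := (d : ℝ) + 1) (by linarith)
    refine ⟨α₀, h1, h2, integrable_norm_rpow_of_tendsto hf_anti hf_pos hf_one h1 h3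
      (hsuper' _ (by linarith)), fun α α₂ h4 h5 => ⟨h, hh, hsub, hratio hsub hminus, ?_⟩⟩
    -- With faster than polynomial decay every positive power of `f` is integrable, so any window
    -- tending to infinity suppresses the intermediate jumps.
    have hη : 0 < α₂ - α := sub_pos.2 h5
    refine tendsto_mul_setIntegral_ball_of_integrable hf_pos hf_zero (h1.trans_le h4) hh
      (integrable_norm_rpow_of_tendsto hf_anti hf_pos hf_one hη
        (p := max 1 (((d : ℝ) + 1) / (α₂ - α))) ?_ (hsuper' _ (le_max_left _ _)))
    have := le_max_right 1 (((d : ℝ) + 1) / (α₂ - α))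
    rw [div_le_iff₀ hη] at this
    linarith

/-- A log-equivalent function is dominated by any smaller power of the profile. -/
theorem ClassD.exists_le_mul_rpow {b₁ : ℝ → ℝ} {α : ℝ} (hb₁ : ClassD d b₁) (hf : Antitone f)
    (hpos : ∀ s, 0 < f s) (hone : ∀ s, f s ≤ 1)
    (hlog : LogEquivalent b₁ f) (hα : 0 ≤ α) (hα1 : α < 1) :
    ∃ C : ℝ, 0 < C ∧ ∀ s, 0 ≤ s → b₁ s ≤ C * f s ^ α := by
  have hev : ∀ᶠ s in atTop, b₁ s ≤ f s ^ α := by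
    -- With constant `1 - α` this gives `log b₁ - log f ≤ -(1 - α) log f`, that is, `log b₁ ≤ α log
    -- f`.
    have h := hlog.isLittleO.def (sub_pos.2 hα1)
    filter_upwards [h, eventually_ge_atTop 0] with s hs hs0
    have hl : Real.log (f s) ≤ 0 := Real.log_nonpos (hpos s).le (hone s)
    simp only [Pi.sub_apply, Real.norm_eq_abs] at hs
    rw [abs_of_nonpos hl] at hs
    have h1 := (le_abs_self _).trans hs
    rw [← Real.log_le_log_iff (hb₁.pos s hs0) (Real.rpow_pos_of_pos (hpos s) α),
      Real.log_rpow (hpos s)]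
    linarith
  obtain ⟨S, hS⟩ := eventually_atTop.1 hev
  obtain ⟨K, hK⟩ := hb₁.bounded
  have hfS : 0 < f S ^ α := Real.rpow_pos_of_pos (hpos S) α
  refine ⟨max 1 (K / f S ^ α), by positivity, fun s hs => ?_⟩
  have hfs : 0 < f s ^ α := Real.rpow_pos_of_pos (hpos s) α
  rcases le_total S s with h | h
  · exact (hS s h).trans (le_mul_of_one_le_left hfs.le (le_max_left _ _))
  · have h1 : f S ^ α ≤ f s ^ α := Real.rpow_le_rpow (hpos S).le (hf h) hα
    have h2 := le_max_right 1 (K / f S ^ α)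
    rw [div_le_iff₀ hfS] at h2
    exact (hK s hs).trans (h2.trans (mul_le_mul_of_nonneg_left h1 (by positivity)))

end ClassEProfile

/-! ### Integrals over orthants. -/

section Orthant

variable {d : ℕ} {a g : Space d → ℝ}

theorem measurableSet_orthant_prod :
    MeasurableSet {p : Space d × Space d | p.2 ∈ orthant p.1} := by
  have : {p : Space d × Space d | p.2 ∈ orthant p.1} = ⋂ j, {p | p.1 j ≤ p.2 j} := by
    ext p; simp [orthant]
  rw [this]
  refine MeasurableSet.iInter fun j => measurableSet_le ?_ ?_
  · exact Continuous.measurable (by fun_prop)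
  · exact Continuous.measurable (by fun_prop)

theorem measurableSet_orthant (x : Space d) : MeasurableSet (orthant x) :=
  measurable_prodMk_left (x := x) measurableSet_orthant_prod

theorem sub_mem_orthant_sub_iff {x y z : Space d} : z - y ∈ orthant (x - y) ↔ z ∈ orthant x := by
  simp [orthant]

theorem setIntegral_orthant_sub (g : Space d → ℝ) (x y : Space d) :
    ∫ z in orthant (x - y), g z = ∫ z in orthant x, g (z - y) := by
  rw [← integral_indicator (measurableSet_orthant _), ← integral_indicator (measurableSet_orthant _),
    ← integral_sub_right_eq_self _ y]
  congr 1 with z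
  by_cases hz : z ∈ orthant x
  · rw [indicator_of_mem hz, indicator_of_mem (sub_mem_orthant_sub_iff.2 hz)]
  · rw [indicator_of_notMem hz, indicator_of_notMem (mt sub_mem_orthant_sub_iff.1 hz)]

theorem measurable_setIntegral_orthant (hg : Measurable g) :
    Measurable fun x => ∫ y in orthant x, g y := by
  have h : StronglyMeasurable fun p : Space d × Space d =>
      {p : Space d × Space d | p.2 ∈ orthant p.1}.indicator (fun p => g p.2) p :=
    ((hg.comp measurable_snd).indicator measurableSet_orthant_prod).stronglyMeasurable
  have h' := (h.integral_prod_right' (ν := volume)).measurable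
  simp only [← integral_indicator (measurableSet_orthant _)]
  exact h'

theorem memLp_top_setIntegral_orthant (hg : Measurable g) (h0 : ∀ x, 0 ≤ g x)
    (hint : Integrable g) : MemLp (fun x => ∫ y in orthant x, g y) ∞ volume :=
  memLp_top_of_measurable_of_le (measurable_setIntegral_orthant hg)
    (fun _ => integral_nonneg h0) (fun _ => setIntegral_le_integral hint (ae_of_all _ h0))

/-- Orthants are translates of one another, so by Fubini integration over them commutes with
convolution and preserves the supersolution inequality. -/
theorem conv_setIntegral_orthant_le (ha : IsBoundedProbabilityKernel a) (hint : Integrable g)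
    {γ : ℝ} (hconv : ∀ x, conv a g x ≤ γ * g x) (x : Space d) :
    conv a (fun x => ∫ y in orthant x, g y) x ≤ γ * ∫ y in orthant x, g y := by
  have hprod : Integrable (fun p : Space d × Space d => a p.2 * g (p.1 - p.2))
      (volume.prod volume) :=
    ha.integrable.convolution_integrand (ContinuousLinearMap.mul ℝ ℝ) hint
  have hci : Integrable (conv a g) := by
    refine hprod.integral_prod_left.congr (ae_of_all _ fun z => ?_)
    rw [conv_eq_integral_sub]
  have hprod' : Integrable (fun p : Space d × Space d => a p.2 * g (p.1 - p.2))
      ((volume.restrict (orthant x)).prod volume) := by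
    have h := hprod.restrict (s := orthant x ×ˢ univ)
    rwa [← Measure.prod_restrict, Measure.restrict_univ] at h
  have key : conv a (fun x => ∫ y in orthant x, g y) x = ∫ z in orthant x, conv a g z := by
    rw [conv_eq_integral_sub]
    simp only [setIntegral_orthant_sub, conv_eq_integral_sub a g, ← integral_const_mul]
    exact (integral_integral_swap hprod').symm
  rw [key, ← integral_const_mul]
  exact setIntegral_mono hci.integrableOn (hint.const_mul γ).integrableOn hconv

/-- Hölder with exponents `1/θ` and `1/(1 - θ)` for the product of `f^θ` and `f^{α₀(1-θ)}`. -/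
theorem TailProfile.setIntegral_rpow_le {f : ℝ → ℝ} {α₀ : ℝ} (hf : TailProfile d f α₀) {θ : ℝ}
    (hθ0 : 0 < θ) (hθ1 : θ < 1) (s : Set (Space d)) :
    ∫ y in s, f ‖y‖ ^ (α₀ + θ * (1 - α₀)) ≤
      (∫ y in s, f ‖y‖) ^ θ * (∫ y : Space d, f ‖y‖ ^ α₀) ^ (1 - θ) := by
  have hθ2 : 0 < 1 - θ := by linarith
  have hpq : (θ⁻¹).HolderConjugate (1 - θ)⁻¹ := by
    rw [Real.holderConjugate_iff]
    exact ⟨(one_lt_inv₀ hθ0).2 hθ1, by simp⟩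
  have hp (α : ℝ) (y : Space d) : 0 < f ‖y‖ ^ α := Real.rpow_pos_of_pos (hf.pos _) α
  have hmem {η : ℝ} (hη : 0 < η) {α : ℝ} (hα : α₀ ≤ α) :
      MemLp (fun y : Space d => f ‖y‖ ^ (α * η)) (ENNReal.ofReal η⁻¹) (volume.restrict s) := by
    have hm : AEStronglyMeasurable (fun y : Space d => f ‖y‖ ^ (α * η)) (volume.restrict s) :=
      (measurable_antitone_norm_rpow hf.antitone _).aestronglyMeasurable
    have hη' : 0 < η⁻¹ := inv_pos.2 hη
    rw [← integrable_norm_rpow_iff hm (by simpa using hη) ENNReal.ofReal_ne_top,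
      ENNReal.toReal_ofReal hη'.le]
    refine (hf.integrable_rpow hα).integrableOn.congr (ae_of_all _ fun y => ?_)
    simp only [Real.norm_of_nonneg (hp _ y).le]
    rw [← Real.rpow_mul (hf.pos _).le, mul_assoc, mul_inv_cancel₀ hη.ne', mul_one]
  have h := integral_mul_le_Lp_mul_Lq_of_nonneg hpq (ae_of_all _ fun y => (hp _ y).le)
    (ae_of_all _ fun y => (hp _ y).le) (hmem hθ0 hf.exponent_lt_one.le) (hmem hθ2 le_rfl)
  simp only [one_div, inv_inv, ← Real.rpow_mul (hf.pos _).le, ← Real.rpow_add (hf.pos _),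
    mul_assoc, mul_inv_cancel₀ hθ0.ne', mul_inv_cancel₀ hθ2.ne', mul_one, one_mul,
    Real.rpow_one] at h
  rw [show θ + α₀ * (1 - θ) = α₀ + θ * (1 - α₀) by ring] at h
  refine h.trans (mul_le_mul_of_nonneg_left ?_ ?_)
  · refine Real.rpow_le_rpow (integral_nonneg fun y => (hp _ y).le) ?_ hθ2.le
    exact setIntegral_le_integral hf.integrable (ae_of_all _ fun y => (hp _ y).le)
  · exact Real.rpow_nonneg (integral_nonneg fun y => (hf.pos _).le) _

theorem ClassD.measurable_comp_norm {b : ℝ → ℝ} (hb : ClassD d b) :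
    Measurable fun x : Space d => b ‖x‖ :=
  hb.measurable.comp
    (Measurable.subtype_mk (h := fun x : Space d => mem_Ici.2 (norm_nonneg x)) measurable_norm)

end Orthant

/-! ### Decay ahead of the front. -/

section Front

variable {d : ℕ} {a : Space d → ℝ} {κ m β : ℝ} {u₀ : LInfty d} {w : ℝ → LInfty d}

/-- A supersolution dominated by a power of `c` yields exponential decay ahead of the front. -/
theorem IsClassicalSolution.essSup_le (ha : IsBoundedProbabilityKernel a)
    (hw : IsClassicalSolution κ m a u₀ w) (hκ : 0 < κ) (hβ : β = κ - m) (hβ_pos : 0 < β)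
    {ε : ℝ} (hε : 0 < ε) {c : Space d → ℝ} (hc0 : ∀ x, 0 ≤ c x) {D : ℝ} (hD : 0 ≤ D)
    {ω : Space d → ℝ} (hω : MemLp ω ∞ volume)
    (hconv : ∀ x, conv a ω x ≤ (1 + ε * β / (4 * κ)) * ω x) (hu : ∀ᵐ x, u₀ x ≤ ω x)
    (hωc : ∀ x, ω x ≤ D * c x ^ ((1 + ε / 2) / (1 + ε))) {t : ℝ} (ht : 0 ≤ t) :
    essSup (fun x => ((w t x : ℝ) : EReal)) (volume.restrict (frontSet β (t + ε * t) c)ᶜ) ≤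
      ((D * Real.exp (-(ε * β / 4) * t) : ℝ) : EReal) := by
  refine essSup_le_of_ae_le _ ?_
  have hmeas : MeasurableSet {x : Space d | w t x ≤ D * Real.exp (-(ε * β / 4) * t)} :=
    measurableSet_le (Lp.stronglyMeasurable (w t)).measurable measurable_const
  suffices H : ∀ᵐ x ∂(volume.restrict (frontSet β (t + ε * t) c)ᶜ),
      w t x ≤ D * Real.exp (-(ε * β / 4) * t) from
    H.mono fun x hx => EReal.coe_le_coe_iff.2 hx
  rw [ae_restrict_iff hmeas]
  filter_upwards [hw.ae_le_of_conv_le ha hκ.le hω (by positivity) (ae_of_all _ hconv) hu ht]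
    with x hx hxc
  have hxc' : c x ≤ Real.exp (-(β * (t + ε * t))) := le_of_not_ge hxc
  have h1 : c x ^ ((1 + ε / 2) / (1 + ε)) ≤ Real.exp (-(β * (1 + ε / 2) * t)) := by
    refine (Real.rpow_le_rpow (hc0 x) hxc' (by positivity)).trans_eq ?_
    rw [← Real.exp_mul]
    congr 1
    field_simp
  refine hx.trans ((mul_le_mul_of_nonneg_left ((hωc x).trans (mul_le_mul_of_nonneg_left h1 hD))
    (Real.exp_pos _).le).trans_eq ?_)
  -- The exponents combine as `β(1 + ε/4) - β(1 + ε/2) = -εβ/4`.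
  rw [mul_left_comm, ← Real.exp_add]
  congr 2
  rw [hβ] at *
  field_simp
  ring

end Front
end NonlocalFront

/-! ### The main theorem. -/

theorem theorem3p1 (d : ℕ) (hd : 1 ≤ d) (κ m β : ℝ) (hm : 0 < m) (hβ : β = κ - m) (hβ_pos : 0 < β)
    (a : Space d → ℝ) (ha : IsBoundedProbabilityKernel a)
    (u₀ : LInfty d) (hu₀ : ∀ᵐ x, 0 ≤ u₀ x)
    (w : ℝ → LInfty d) (hw : IsClassicalSolution κ m a u₀ w)
    (b b₁ b₂ : ℝ → ℝ) (hb : ClassE d b) (hb₁ : ClassD d b₁) (hb₂ : ClassD d b₂)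
    (hlog₁ : LogEquivalent b₁ b) (hlog₂ : LogEquivalent b₂ b)
    (hab₁ : ∀ᵐ x, a x ≤ radial b₁ x)
    (c : Space d → ℝ)
    (hc : ((∀ᵐ x, u₀ x ≤ radial b₂ x) ∧ c = radial b) ∨
      ((∀ᵐ x, u₀ x ≤ orthantIntegral b₂ x) ∧ c = orthantIntegral b)) :
    ∃ ε₀ : ℝ, 0 < ε₀ ∧ ∀ ε : ℝ, 0 < ε → ε < ε₀ →
      ∃ C τ : ℝ, 0 < C ∧ 0 < τ ∧ ∀ t : ℝ, τ ≤ t →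
        essSup (fun x => ((w t x : ℝ) : EReal))
            (volume.restrict (frontSet β (t + ε * t) c)ᶜ) ≤
          ((C * Real.exp (-(ε * β / 4) * t) : ℝ) : EReal) := by
  refine ⟨1, one_pos, fun ε hε _ => ?_⟩
  have hκ : 0 < κ := by linarith
  obtain ⟨f, α₀, hf, hfb, K, hK, hKb⟩ := hb.exists_tailProfile hd
  have hlogf {p : ℝ → ℝ} (hp : LogEquivalent p b) : LogEquivalent p f :=
    hp.congr_right (hfb.mono fun s hs => by simp only [hs])
  set θ := (1 + ε / 2) / (1 + ε) with hθ
  have hθ0 : 0 < θ := by positivity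
  have hθ1 : θ < 1 := (div_lt_one (by positivity)).2 (by linarith)
  -- The exponent dictated by Hölder in the orthant case. It also satisfies `θ ≤ α`, which gives
  -- `f^α ≤ f^θ` in the radial case, and `α < 1` leaves room for the kernel exponent `(α + 1)/2`
  -- above `α`.
  set α := α₀ + θ * (1 - α₀) with hα
  have hα₀1 := hf.exponent_lt_one
  have hα₀0 := hf.exponent_pos
  have hα₀ : α₀ ≤ α := by nlinarith
  have hαθ : θ ≤ α := by nlinarith
  have hα1 : α < 1 := by nlinarith
  have hα0 : 0 < α := by linarith
  set γ := 1 + ε * β / (4 * κ) with hγ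
  have hγ1 : 1 < γ := lt_add_of_pos_right _ (by positivity)
  obtain ⟨C₁, hC₁, hbC₁⟩ := hb₁.exists_le_mul_rpow hf.antitone hf.pos hf.le_one (hlogf hlog₁)
    (α := (α + 1) / 2) (by linarith) (by linarith)
  obtain ⟨C₂, hC₂, hbC₂⟩ := hb₂.exists_le_mul_rpow hf.antitone hf.pos hf.le_one (hlogf hlog₂)
    hα0.le hα1
  obtain ⟨R, -, hR⟩ := hf.exists_supersolution ha hα₀ (α₂ := (α + 1) / 2) (by linarith) hC₁.le
    (hab₁.mono fun x hx => hx.trans (hbC₁ _ (norm_nonneg x))) hγ1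
  have hp (η s : ℝ) : 0 < f s ^ η := Real.rpow_pos_of_pos (hf.pos s) η
  set q : Space d → ℝ := fun y => f (max ‖y‖ R) ^ α with hq
  have hq0 (y : Space d) : 0 ≤ q y := (hp _ _).le
  have hqm : Measurable q :=
    (hf.antitone.measurable.comp (measurable_norm.max measurable_const)).pow_const α
  have hqf (y : Space d) : q y ≤ f ‖y‖ ^ α :=
    Real.rpow_le_rpow (hf.pos _).le (hf.antitone (le_max_left _ _)) hα0.le
  have hqi : Integrable q := by
    refine (hf.integrable_rpow hα₀).mono' hqm.aestronglyMeasurable (ae_of_all _ fun y => ?_)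
    rw [Real.norm_of_nonneg (hq0 y)]
    exact hqf y
  -- The factor that compensates for the flattening below radius `R`.
  set L := (f R ^ α)⁻¹ with hL
  have hL0 : 0 < L := inv_pos.2 (hp _ _)
  have hfq (y : Space d) : f ‖y‖ ^ α ≤ L * q y := by
    have hone (s : ℝ) : f s ^ α ≤ 1 := rpow_le_one_of_mem_Ioc hf.pos hf.le_one hα0.le s
    rw [hL, inv_mul_eq_div, le_div_iff₀ (hp _ _), hq]
    rcases le_total ‖y‖ R with h | h
    · simp only [max_eq_right h]
      exact mul_le_of_le_one_left (hp _ _).le (hone _)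
    · simp only [max_eq_left h]
      exact mul_le_of_le_one_right (hp _ _).le (hone _)
  have hb₂q (y : Space d) : b₂ ‖y‖ ≤ C₂ * L * q y := by
    rw [mul_assoc]
    exact (hbC₂ _ (norm_nonneg y)).trans (mul_le_mul_of_nonneg_left (hfq y) hC₂.le)
  have hscale {v : Space d → ℝ} (hv : ∀ x, conv a v x ≤ γ * v x) (x : Space d) :
      conv a ((C₂ * L) • v) x ≤ γ * ((C₂ * L) • v) x := by
    rw [conv_smul, Pi.smul_apply, Pi.smul_apply, smul_eq_mul, smul_eq_mul, mul_left_comm]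
    exact mul_le_mul_of_nonneg_left (hv x) (by positivity)
  rcases hc with ⟨hu, rfl⟩ | ⟨hu, rfl⟩
  · refine ⟨C₂ * L * K ^ θ, 1, by positivity, one_pos, fun t ht =>
      hw.essSup_le ha hκ hβ hβ_pos hε (fun x => (hb.pos _ (norm_nonneg x)).le) (by positivity)
        (ω := (C₂ * L) • q) ?_ (hscale hR)
        (hu.mono fun x hx => hx.trans (hb₂q x)) (fun x => ?_) (by linarith)⟩
    · exact (memLp_top_of_measurable_of_le hqm hq0 fun y => (hqf y).trans
        (rpow_le_one_of_mem_Ioc hf.pos hf.le_one hα0.le _)).const_smul _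
    · rw [Pi.smul_apply, smul_eq_mul, mul_assoc (C₂ * L)]
      refine mul_le_mul_of_nonneg_left ?_ (mul_pos hC₂ hL0).le
      rw [← Real.mul_rpow hK.le (hb.pos _ (norm_nonneg x)).le]
      exact (hqf x).trans ((Real.rpow_le_rpow_of_exponent_ge (hf.pos _) (hf.le_one _) hαθ).trans
        (Real.rpow_le_rpow (hf.pos _).le (hKb _ (norm_nonneg x)).2 hθ0.le))
  · have hc0 (x : Space d) : 0 ≤ orthantIntegral b x :=
      integral_nonneg fun y => (hb.pos _ (norm_nonneg y)).le
    have hfi : Integrable fun y : Space d => f ‖y‖ := by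
      simpa using hf.integrable_rpow hα₀1.le
    have hbi : Integrable fun y : Space d => b ‖y‖ := by
      refine (hfi.const_mul K).mono' hb.toClassD.measurable_comp_norm.aestronglyMeasurable
        (ae_of_all _ fun y => ?_)
      rw [Real.norm_of_nonneg (hb.pos _ (norm_nonneg y)).le]
      exact (hKb _ (norm_nonneg y)).1
    set I := (∫ y : Space d, f ‖y‖ ^ α₀) ^ (1 - θ)
    have hI : 0 ≤ I := Real.rpow_nonneg (integral_nonneg fun y => (hp _ _).le) _
    set Q : Space d → ℝ := fun x => ∫ y in orthant x, q y
    have hQ (x : Space d) : Q x ≤ K ^ θ * I * orthantIntegral b x ^ θ := calc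
      Q x ≤ ∫ y in orthant x, f ‖y‖ ^ α :=
        setIntegral_mono hqi.integrableOn (hf.integrable_rpow hα₀).integrableOn hqf
      _ ≤ (∫ y in orthant x, f ‖y‖) ^ θ * I := hf.setIntegral_rpow_le hθ0 hθ1 _
      _ ≤ (K * orthantIntegral b x) ^ θ * I := by
        refine mul_le_mul_of_nonneg_right (Real.rpow_le_rpow
          (integral_nonneg fun y => (hf.pos _).le) ?_ hθ0.le) hI
        rw [orthantIntegral, ← integral_const_mul]
        exact setIntegral_mono hfi.integrableOn (hbi.const_mul K).integrableOn
          fun y => (hKb _ (norm_nonneg y)).2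
      _ = K ^ θ * I * orthantIntegral b x ^ θ := by
        rw [Real.mul_rpow hK.le (hc0 x)]; ring
    -- The added 1 makes the constant positive, since `I` is only shown to be nonnegative.
    refine ⟨C₂ * L * (K ^ θ * I) + 1, 1, by positivity, one_pos, fun t ht =>
      hw.essSup_le ha hκ hβ hβ_pos hε hc0 (by positivity) (ω := (C₂ * L) • Q)
        ((memLp_top_setIntegral_orthant hqm hq0 hqi).const_smul _)
        (hscale (conv_setIntegral_orthant_le ha hqi hR))
        (hu.mono fun x hx => hx.trans ?_) (fun x => ?_) (by linarith)⟩
    · rw [Pi.smul_apply, smul_eq_mul, ← integral_const_mul]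
      exact integral_mono_of_nonneg (ae_of_all _ fun y => (hb₂.pos _ (norm_nonneg y)).le)
        (hqi.const_mul _).integrableOn (ae_of_all _ hb₂q)
    · rw [Pi.smul_apply, smul_eq_mul, add_mul, mul_assoc (C₂ * L)]
      have h1 := mul_le_mul_of_nonneg_left (hQ x) (mul_pos hC₂ hL0).le
      have h2 := Real.rpow_nonneg (hc0 x) θ
      linarith
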